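/- Let $\mathcal I$ be the set of compact intervals $Q=[\underline q,\overline q]\subset\mathbb R$ ($\underline q\le\overline q$), with $Q+R=[\underline q+\underline r,\overline q+\overline r]$, center $q^c=\frac{\underline q+\overline q}2$ and width $q^w=\frac{\overline q-\underline q}2$; write $Q\prec_{CW}R$ if $q^c<r^c$ and $q^w<r^w$. Let $F_k:\mathbb R^n\to\mathcal I$ $(k=1,\dots,m)$ and $g_j:\mathbb R^n\to\mathbb R$ $(j=1,\dots,p)$ be locally Lipschitz continuous, where an interval-valued $f=[\underline f,\overline f]$ is called locally Lipschitz continuous if every $u_0\in\mathbb R^n$ has a neighbourhood $U$ and a constant $L>0$ with $\max\{|\underline f(u_1)-\underline f(u_2)|,|\overline f(u_1)-\overline f(u_2)|\}\le L\|u_1-u_2\|$ for all $u_1,u_2\in U$ ($\|\cdot\|$ is the Euclidean norm). Let $S=\{u\in\mathbb R^n: g_j(u)\le 0 \text{ for all } j\}$. For a locally Lipschitz $\psi:\mathbb R^n\to\mathbb R$ let $\partial^0\psi(z)$ be the Clarke generalized gradient, i.e. the set of all $z^*\in\mathbb R^n$ with $\langle z^*,w\rangle\le\limsup_{u\to z,\,t\to0^+}\frac{\psi(u+tw)-\psi(u)}t$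 for all $w\in\mathbb R^n$. For a locally Lipschitz $f:\mathbb R^n\to\mathcal I$ with center $f^c$ and width $f^w$ let $\partial^0f(u)$ be the convex hull of $\partial^0f^c(u)\cup\partial^0f^w(u)$. Let $\mathbb B^n$ be the closed unit ball of $\mathbb R^n$. The basic constraint qualification (BCQ) holds at $u\in S$ if there is no $\mu\in\mathbb R^p_+\setminus\{0\}$ with $\mu_j=0$ whenever $g_j(u)\neq0$ and $0\in\sum_{j=1}^p\mu_j\,\partial^0g_j(u)$. Let $\varepsilon=(\varepsilon_1,\dots,\varepsilon_m)\in\mathbb R^m_+\setminus\{0\}$, and let $\overline u\in S$ be a locally weak $\varepsilon$-quasi-minimal solution, i.e. there is a neighbourhood $U$ of $\overline u$ such that no $z\in S\cap U$ satisfies $F_k(z)+[0,\varepsilon_k\|z-\overline u\|]\prec_{CW}F_k(\overline u)$ for all $k=1,\dots,m$. Suppose that BCQ holds at every point of $S$ in some neighbourhood of $\overline u$. Let $\epsilon_i>0$ $(i=1,2,\dots)$ with $\epsilon_i\to0$. Then for every sequence $\{x_i\}$ in $S$ with $x_i\to\overline u$ there is a subsequence $\{z_i\}$ of $\{x_i\}$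 such that for every $i$ there is $y_i\in S$ satisfying (i) $\|z_i-y_i\|\le\sqrt{\epsilon_i}$; (ii) there exist $\lambda^i\in\mathbb R^m_+$ with $\sum_{k=1}^m\lambda^i_k=1$, $\mu^i\in\mathbb R^p_+$, $u^i_k\in\partial^0F_k(y_i)+\varepsilon_k\mathbb B^n$ for all $k=1,\dots,m$, and $v^i_j\in\partial^0g_j(y_i)$ for all $j=1,\dots,p$, such that $$\Big\|\sum_{k=1}^m\lambda^i_ku^i_k+\sum_{j=1}^p\mu^i_jv^i_j\Big\|\le\sqrt{\epsilon_i}\qquad\text{and}\qquad\sum_{j=1}^p\mu^i_jg_j(y_i)=0 .$$ -/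

import Mathlib

open scoped Topology NNReal Pointwise

noncomputable section

namespace MIOP

/-- The set `𝓘` of compact intervals `Q = [Q.fst, Q.snd]` of the real line. Its addition and
subtraction are the usual (Minkowski) ones: `Q + R = [Q.fst + R.fst, Q.snd + R.snd]` and
`Q - R = [Q.fst - R.snd, Q.snd - R.fst]`. The inclusion order that Mathlib puts on it is not
used. -/
abbrev Itv : Type := NonemptyInterval ℝ

/-- Euclidean `n`-space. -/
abbrev Eucl (n : ℕ) : Type := EuclideanSpace ℝ (Fin n)

/-- The center `(Q.fst + Q.snd) / 2` of an interval. -/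
def Itv.center (Q : Itv) : ℝ := (Q.fst + Q.snd) / 2

/-- The width (half-length) `(Q.snd - Q.fst) / 2` of an interval. -/
def Itv.width (Q : Itv) : ℝ := (Q.snd - Q.fst) / 2

/-- The strict center-width order on intervals. -/
def Itv.CWLt (Q R : Itv) : Prop := Itv.center Q < Itv.center R ∧ Itv.width Q < Itv.width R

/-- The norm `max (|Q.fst|) (|Q.snd|)` of an interval. -/
def Itv.size (Q : Itv) : ℝ := max |Q.fst| |Q.snd|

/-- The interval `[0, r]` for `r ≥ 0`. -/
def Itv.zeroTo (r : ℝ≥0) : Itv := ⟨((0 : ℝ), (r : ℝ)), r.2⟩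

/-- The generalized Hukuhara difference of two intervals; it is characterized by
`Itv.gHDiff_eq_iff`. -/
def Itv.gHDiff (Q R : Itv) : Itv :=
  ⟨(min (Q.fst - R.fst) (Q.snd - R.snd), max (Q.fst - R.fst) (Q.snd - R.snd)), min_le_max⟩

theorem Itv.gHDiff_eq_iff (Q R P : Itv) :
    Itv.gHDiff Q R = P ↔ Q = R + P ∨ R = Q - P := by
  have hP := P.fst_le_snd
  simp only [NonemptyInterval.ext_iff, Prod.ext_iff, NonemptyInterval.toProd_add,
    NonemptyInterval.fst_sub, NonemptyInterval.snd_sub, Itv.gHDiff, Prod.fst_add, Prod.snd_add]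
  rcases le_total (Q.fst - R.fst) (Q.snd - R.snd) with h | h
  · rw [min_eq_left h, max_eq_right h]
    constructor
    · rintro ⟨h1, h2⟩
      left
      constructor <;> linarith
    · rintro (⟨h1, h2⟩ | ⟨h1, h2⟩) <;> constructor <;> linarith
  · rw [min_eq_right h, max_eq_left h]
    constructor
    · rintro ⟨h1, h2⟩
      right
      constructor <;> linarith
    · rintro (⟨h1, h2⟩ | ⟨h1, h2⟩) <;> constructor <;> linarith

/-- Local Lipschitz continuity of an interval-valued function on `ℝⁿ`. -/
def LocLipschitzItv {n : ℕ} (f : Eucl n → Itv) : Prop :=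
  ∀ u₀ : Eucl n, ∃ U ∈ 𝓝 u₀, ∃ L : ℝ, 0 < L ∧ ∀ u₁ ∈ U, ∀ u₂ ∈ U,
    Itv.size (Itv.gHDiff (f u₁) (f u₂)) ≤ L * ‖u₁ - u₂‖

/-- The Clarke directional derivative of `ψ` at `z` in the direction `w`: the upper limit of
`(ψ (u + t w) - ψ u) / t` as `u → z` and `t → 0⁺`. It is meant for locally Lipschitz `ψ`, for which
these quotients are bounded near `z`. -/
def clarkeDeriv {n : ℕ} (ψ : Eucl n → ℝ) (z w : Eucl n) : ℝ :=
  Filter.limsup (fun q : Eucl n × ℝ => (ψ (q.1 + q.2 • w) - ψ q.1) / q.2)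
    (𝓝 z ×ˢ 𝓝[>] (0 : ℝ))

/-- The (Clarke) generalized gradient of `ψ` at `z`. -/
def clarkeGradient {n : ℕ} (ψ : Eucl n → ℝ) (z : Eucl n) : Set (Eucl n) :=
  {zs | ∀ w : Eucl n, inner ℝ zs w ≤ clarkeDeriv ψ z w}

/-- The weakly generalized gradient of an interval-valued function: the convex hull of the
generalized gradients of its center and of its width. -/
def weakGradient {n : ℕ} (f : Eucl n → Itv) (u : Eucl n) : Set (Eucl n) :=
  convexHull ℝ (clarkeGradient (fun z => Itv.center (f z)) u ∪
    clarkeGradient (fun z => Itv.width (f z)) u)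

/-- The feasible set `S = {u | g_j(u) ≤ 0 for all j}`. -/
def feasible {n p : ℕ} (g : Fin p → Eucl n → ℝ) : Set (Eucl n) :=
  {u | ∀ j, g j u ≤ 0}

/-- `z₀` is a locally weak `ε`-quasi-minimal solution of the problem of minimizing
`(F_1, …, F_m)` over `S`: it is feasible and, for some neighbourhood `U` of `z₀`, no `z ∈ S ∩ U`
satisfies `F_k(z) + [0, ε_k ‖z - z₀‖] ≺ F_k(z₀)` for all `k`. -/
def IsLocWeakQuasiMin {n m : ℕ} (F : Fin m → Eucl n → Itv) (S : Set (Eucl n))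
    (ε : Fin m → ℝ≥0) (z₀ : Eucl n) : Prop :=
  z₀ ∈ S ∧ ∃ U ∈ 𝓝 z₀, ¬ ∃ z ∈ S ∩ U, ∀ k,
    Itv.CWLt (F k z + Itv.zeroTo (ε k * ‖z - z₀‖₊)) (F k z₀)

/-- The basic constraint qualification at a (feasible) point `u`: there is no nonzero `μ ≥ 0`,
vanishing at every inactive index, with `0 ∈ ∑ j, μ_j ∂⁰g_j(u)`. -/
def BCQ {n p : ℕ} (g : Fin p → Eucl n → ℝ) (u : Eucl n) : Prop :=
  ¬ ∃ μ : Fin p → ℝ, μ ≠ 0 ∧ (∀ j, 0 ≤ μ j) ∧ (∀ j, g j u ≠ 0 → μ j = 0) ∧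
    (0 : Eucl n) ∈ ∑ j, μ j • clarkeGradient (g j) u

end MIOP

end

/-! The point `ubar` itself serves as every `y`: it satisfies exact KKT conditions, so the
combination of gradients is `0`, and (i) only asks for a subsequence of `x` converging to `ubar`
fast enough.

The KKT conditions come from a theorem of the alternative. A direction making an obtuse angle with
every element of all enlarged objective gradients and all active constraint gradients would be a
feasible descent direction, against quasi-minimality (`exists_inner_nonneg`). These sets are compact
and convex, so their convex combinations form a compact convex set, and separating `0` from it would
produce such a direction (`zero_mem_weightedSums`). Hence `0` is a convex combination; BCQ keeps the
objectives' total weight positive, and dividing by it normalises the multipliers. The link between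
gradients and directional derivatives is that the Clarke derivative is attained as the support
function of the gradient (`exists_mem_clarkeGradient`). -/

/-- The set of all convex combinations with one point from each of the sets `C a`. -/
def weightedSums {ι E : Type*} [Fintype ι] [AddCommGroup E] [Module ℝ E] (C : ι → Set E) : Set E :=
  (fun q : (ι → ℝ) × (ι → E) => ∑ a, q.1 a • q.2 a) '' (stdSimplex ℝ ι ×ˢ Set.univ.pi C)

/-! ### Convex combinations of finitely many compact convex sets -/

section WeightedSums

variable {ι E : Type*} [Fintype ι] [NormedAddCommGroup E] [NormedSpace ℝ E] {C : ι → Set E}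

theorem isCompact_weightedSums (hC : ∀ a, IsCompact (C a)) : IsCompact (weightedSums C) := by
  refine ((isCompact_stdSimplex ℝ ι).prod (isCompact_univ_pi hC)).image ?_
  fun_prop

theorem convex_weightedSums (hC : ∀ a, Convex ℝ (C a)) : Convex ℝ (weightedSums C) := by
  rintro _ ⟨⟨l, c⟩, ⟨hl, hc⟩, rfl⟩ _ ⟨⟨l', c'⟩, ⟨hl', hc'⟩, rfl⟩ α β hα hβ hαβ
  -- Convexity merges the two points of `C a` into one carrying the combined weight, even when that
  -- weight is zero.
  have key : ∀ a, ∃ d ∈ C a, (α * l a + β * l' a) • d = (α * l a) • c a + (β * l' a) • c' a :=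
    fun a => (hC a).exists_mem_add_smul_eq (hc a (Set.mem_univ a)) (hc' a (Set.mem_univ a))
      (mul_nonneg hα (hl.1 a)) (mul_nonneg hβ (hl'.1 a))
  choose d hdC hd using key
  refine ⟨(α • l + β • l', d), ⟨convex_stdSimplex ℝ ι hl hl' hα hβ hαβ, fun a _ => hdC a⟩, ?_⟩
  simp only [Pi.add_apply, Pi.smul_apply, smul_eq_mul, hd, Finset.sum_add_distrib, Finset.smul_sum,
    mul_smul]

theorem subset_weightedSums (hne : ∀ a, (C a).Nonempty) (a : ι) : C a ⊆ weightedSums C := by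
  classical
  intro c hc
  choose d hd using hne
  refine ⟨(Pi.single a 1, Function.update d a c), ⟨single_mem_stdSimplex ℝ a, fun b _ => ?_⟩, ?_⟩
  · by_cases h : b = a
    · subst h; simpa using hc
    · simpa [h] using hd b
  · simp [Pi.single_apply, ite_smul]

theorem weightedSums_subset_convexHull : weightedSums C ⊆ convexHull ℝ (⋃ a, C a) := by
  rintro _ ⟨⟨l, c⟩, ⟨hl, hc⟩, rfl⟩
  exact (convex_convexHull ℝ _).sum_mem (fun a _ => hl.1 a) hl.2 fun a _ =>
    subset_convexHull ℝ _ (Set.mem_iUnion.2 ⟨a, hc a (Set.mem_univ a)⟩)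

theorem convexHull_iUnion_eq_weightedSums (hne : ∀ a, (C a).Nonempty)
    (hC : ∀ a, Convex ℝ (C a)) : convexHull ℝ (⋃ a, C a) = weightedSums C :=
  (convexHull_min (Set.iUnion_subset (subset_weightedSums hne)) (convex_weightedSums hC)).antisymm
    weightedSums_subset_convexHull

theorem isCompact_convexHull_union {A B : Set E} (hA : IsCompact A) (hB : IsCompact B)
    (hA' : Convex ℝ A) (hB' : Convex ℝ B) (hAn : A.Nonempty) (hBn : B.Nonempty) :
    IsCompact (convexHull ℝ (A ∪ B)) := by
  rw [Set.union_eq_iUnion, convexHull_iUnion_eq_weightedSums]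
  · exact isCompact_weightedSums (by rintro (_ | _) <;> assumption)
  all_goals rintro (_ | _) <;> assumption

/-- If every direction makes a non-obtuse angle with a point of one of the sets, then `0` is a
convex combination of points of these sets. -/
theorem zero_mem_weightedSums {H : Type*} [NormedAddCommGroup H] [InnerProductSpace ℝ H]
    [CompleteSpace H] {D : ι → Set H} (hcomp : ∀ a, IsCompact (D a))
    (hconv : ∀ a, Convex ℝ (D a)) (hne : ∀ a, (D a).Nonempty)
    (h : ∀ w : H, ∃ a, ∃ c ∈ D a, 0 ≤ inner ℝ c w) : (0 : H) ∈ weightedSums D := by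
  by_contra h0
  obtain ⟨f, r, hf, hr⟩ := geometric_hahn_banach_closed_point (convex_weightedSums hconv)
    (isCompact_weightedSums hcomp).isClosed h0
  -- The test direction is the Riesz representative of the separating functional, which is negative
  -- on every `D a`.
  obtain ⟨a, c, hc, hcw⟩ := h ((InnerProductSpace.toDual ℝ H).symm f)
  have h1 := hf c (subset_weightedSums hne a hc)
  rw [real_inner_comm, InnerProductSpace.toDual_symm_apply] at hcw
  rw [map_zero] at hr
  linarith

end WeightedSums

namespace MIOP

open Filter

/-! ### Clarke derivative and generalized gradient -/

section Clarke

variable {n : ℕ} {ψ : Eucl n → ℝ} {z w : Eucl n}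

/-- The difference quotient whose upper limit is the Clarke directional derivative. -/
noncomputable def diffQuot (ψ : Eucl n → ℝ) (w : Eucl n) (q : Eucl n × ℝ) : ℝ :=
  (ψ (q.1 + q.2 • w) - ψ q.1) / q.2

theorem tendsto_add_smul (z w : Eucl n) :
    Tendsto (fun q : Eucl n × ℝ => q.1 + q.2 • w) (𝓝 z ×ˢ 𝓝[>] (0 : ℝ)) (𝓝 z) := by
  have h : Tendsto (fun q : Eucl n × ℝ => q.1 + q.2 • w) (𝓝 (z, (0 : ℝ))) (𝓝 z) := by
    have : Continuous (fun q : Eucl n × ℝ => q.1 + q.2 • w) := by fun_prop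
    simpa using this.tendsto (z, (0 : ℝ))
  rw [nhds_prod_eq] at h
  exact h.mono_left (prod_mono_right _ nhdsWithin_le_nhds)

theorem eventually_snd_pos (z : Eucl n) : ∀ᶠ q in 𝓝 z ×ˢ 𝓝[>] (0 : ℝ), 0 < q.2 :=
  tendsto_snd.eventually self_mem_nhdsWithin

/-- One constant serves all directions: this makes the upper limits finite and later bounds the
gradient. -/
theorem exists_abs_diffQuot_le (hψ : LocallyLipschitz ψ) (z : Eucl n) :
    ∃ L : ℝ, ∀ w, ∀ᶠ q in 𝓝 z ×ˢ 𝓝[>] (0 : ℝ), |diffQuot ψ w q| ≤ L * ‖w‖ := by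
  obtain ⟨K, U, hU, hK⟩ := hψ z
  refine ⟨K, fun w => ?_⟩
  filter_upwards [(tendsto_add_smul z w).eventually hU, tendsto_fst.eventually hU,
    eventually_snd_pos z] with q h1 h2 h3
  have := hK.dist_le_mul _ h1 _ h2
  rw [Real.dist_eq, dist_eq_norm, add_sub_cancel_left, norm_smul, Real.norm_of_nonneg h3.le] at this
  rw [diffQuot, abs_div, abs_of_pos h3, div_le_iff₀ h3]
  linarith

theorem isBoundedUnder_diffQuot (hψ : LocallyLipschitz ψ) (z w : Eucl n) :
    IsBoundedUnder (· ≤ ·) (𝓝 z ×ˢ 𝓝[>] (0 : ℝ)) (diffQuot ψ w) := by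
  obtain ⟨L, hL⟩ := exists_abs_diffQuot_le hψ z
  exact isBoundedUnder_of_eventually_le ((hL w).mono fun q h => (abs_le.1 h).2)

theorem isCoboundedUnder_diffQuot (hψ : LocallyLipschitz ψ) (z w : Eucl n) :
    IsCoboundedUnder (· ≤ ·) (𝓝 z ×ˢ 𝓝[>] (0 : ℝ)) (diffQuot ψ w) := by
  obtain ⟨L, hL⟩ := exists_abs_diffQuot_le hψ z
  exact (isBoundedUnder_of_eventually_ge
    ((hL w).mono fun q h => (abs_le.1 h).1)).isCoboundedUnder_le

theorem eventually_diffQuot_lt (hψ : LocallyLipschitz ψ) {b : ℝ} (h : clarkeDeriv ψ z w < b) :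
    ∀ᶠ q in 𝓝 z ×ˢ 𝓝[>] (0 : ℝ), diffQuot ψ w q < b :=
  eventually_lt_of_limsup_lt h (isBoundedUnder_diffQuot hψ z w)

theorem clarkeDeriv_le (hψ : LocallyLipschitz ψ) {b : ℝ}
    (h : ∀ᶠ q in 𝓝 z ×ˢ 𝓝[>] (0 : ℝ), diffQuot ψ w q ≤ b) : clarkeDeriv ψ z w ≤ b :=
  limsup_le_of_le (isCoboundedUnder_diffQuot hψ z w) h

theorem exists_clarkeDeriv_le_mul_norm (hψ : LocallyLipschitz ψ) (z : Eucl n) :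
    ∃ L : ℝ, ∀ w, clarkeDeriv ψ z w ≤ L * ‖w‖ := by
  obtain ⟨L, hL⟩ := exists_abs_diffQuot_le hψ z
  exact ⟨L, fun w => clarkeDeriv_le hψ ((hL w).mono fun q h => (abs_le.1 h).2)⟩

theorem clarkeDeriv_add_le (hψ : LocallyLipschitz ψ) (z w w' : Eucl n) :
    clarkeDeriv ψ z (w + w') ≤ clarkeDeriv ψ z w + clarkeDeriv ψ z w' := by
  refine le_of_forall_pos_le_add fun δ hδ => clarkeDeriv_le hψ ?_
  have h1 := eventually_diffQuot_lt hψ (z := z) (w := w) (lt_add_of_pos_right _ (half_pos hδ))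
  have h2 := eventually_diffQuot_lt hψ (z := z) (w := w') (lt_add_of_pos_right _ (half_pos hδ))
  -- The base point also varies in the upper limit, so it may be moved by `q.2 • w'` and the
  -- quotient telescopes.
  have hshift : Tendsto (fun q : Eucl n × ℝ => (q.1 + q.2 • w', q.2)) (𝓝 z ×ˢ 𝓝[>] (0 : ℝ))
      (𝓝 z ×ˢ 𝓝[>] (0 : ℝ)) := (tendsto_add_smul z w').prodMk tendsto_snd
  filter_upwards [hshift.eventually h1, h2] with q h1 h2
  have : diffQuot ψ (w + w') q = diffQuot ψ w (q.1 + q.2 • w', q.2) + diffQuot ψ w' q := by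
    simp only [diffQuot, ← add_div]
    rw [show q.1 + q.2 • (w + w') = q.1 + q.2 • w' + q.2 • w by rw [smul_add]; abel]
    ring
  linarith

theorem clarkeDeriv_smul_le (hψ : LocallyLipschitz ψ) (z w : Eucl n) {c : ℝ} (hc : 0 < c) :
    clarkeDeriv ψ z (c • w) ≤ c * clarkeDeriv ψ z w := by
  refine le_of_forall_pos_le_add fun δ hδ => clarkeDeriv_le hψ ?_
  have h1 := eventually_diffQuot_lt hψ (z := z) (w := w) (lt_add_of_pos_right _ (div_pos hδ hc))
  have hmul : Tendsto (fun t : ℝ => t * c) (𝓝[>] (0 : ℝ)) (𝓝[>] (0 : ℝ)) := by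
    refine tendsto_nhdsWithin_iff.2 ⟨?_, ?_⟩
    · have : Tendsto (fun t : ℝ => t * c) (𝓝 0) (𝓝 (0 * c)) := (continuous_mul_const c).tendsto 0
      rw [zero_mul] at this
      exact this.mono_left nhdsWithin_le_nhds
    · filter_upwards [self_mem_nhdsWithin] with t ht using mul_pos ht hc
  have hscale : Tendsto (fun q : Eucl n × ℝ => (q.1, q.2 * c)) (𝓝 z ×ˢ 𝓝[>] (0 : ℝ))
      (𝓝 z ×ˢ 𝓝[>] (0 : ℝ)) := tendsto_fst.prodMk (hmul.comp tendsto_snd)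
  filter_upwards [hscale.eventually h1, eventually_snd_pos z] with q h1 h2
  have : diffQuot ψ (c • w) q = c * diffQuot ψ w (q.1, q.2 * c) := by
    simp only [diffQuot, smul_smul]
    field_simp
  rw [this]
  calc c * diffQuot ψ w (q.1, q.2 * c) ≤ c * (clarkeDeriv ψ z w + δ / c) := by gcongr
    _ = c * clarkeDeriv ψ z w + δ := by field_simp

theorem clarkeDeriv_smul (hψ : LocallyLipschitz ψ) (z w : Eucl n) {c : ℝ} (hc : 0 < c) :
    clarkeDeriv ψ z (c • w) = c * clarkeDeriv ψ z w := by
  refine (clarkeDeriv_smul_le hψ z w hc).antisymm ?_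
  have := clarkeDeriv_smul_le hψ z (c • w) (inv_pos.2 hc)
  rw [inv_smul_smul₀ hc.ne', ← div_eq_inv_mul, le_div_iff₀ hc] at this
  linarith

theorem clarkeDeriv_zero (hψ : LocallyLipschitz ψ) (z : Eucl n) : clarkeDeriv ψ z 0 = 0 := by
  have := clarkeDeriv_smul hψ z 0 (c := 2) two_pos
  rw [smul_zero] at this
  linarith

/-- Hahn-Banach: the functional `c • w ↦ c * clarkeDeriv ψ z w` on the line through `w` extends
below the sublinear `clarkeDeriv ψ z`. -/
theorem exists_mem_clarkeGradient (hψ : LocallyLipschitz ψ) (z w : Eucl n) :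
    ∃ zs ∈ clarkeGradient ψ z, inner ℝ zs w = clarkeDeriv ψ z w := by
  let f : Eucl n →ₗ.[ℝ] ℝ := LinearPMap.mkSpanSingleton' w (clarkeDeriv ψ z w) (by
    intro c hc
    rcases smul_eq_zero.1 hc with h | h
    · simp [h]
    · simp [h, clarkeDeriv_zero hψ])
  obtain ⟨φ, hφ, hle⟩ := exists_extension_of_le_sublinear f (clarkeDeriv ψ z)
    (fun c hc x => clarkeDeriv_smul hψ z x hc) (clarkeDeriv_add_le hψ z) (by
      rintro ⟨x, hx⟩
      obtain ⟨c, rfl⟩ := Submodule.mem_span_singleton.1 hx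
      rw [LinearPMap.mkSpanSingleton'_apply, RingHom.id_apply, smul_eq_mul]
      rcases lt_trichotomy c 0 with h | h | h
      · have h1 := clarkeDeriv_add_le hψ z (c • w) ((-c) • w)
        rw [← add_smul, add_neg_cancel, zero_smul, clarkeDeriv_zero hψ,
          clarkeDeriv_smul hψ z w (neg_pos.2 h)] at h1
        show _ ≤ clarkeDeriv ψ z (c • w)
        linarith
      · simp [h, clarkeDeriv_zero hψ]
      · exact (clarkeDeriv_smul hψ z w h).ge)
  let φ' : StrongDual ℝ (Eucl n) := LinearMap.toContinuousLinearMap φ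
  have hin : ∀ x, inner ℝ ((InnerProductSpace.toDual ℝ (Eucl n)).symm φ') x = φ x := fun x => by
    rw [InnerProductSpace.toDual_symm_apply]; rfl
  refine ⟨(InnerProductSpace.toDual ℝ (Eucl n)).symm φ', fun x => ?_, ?_⟩
  · rw [hin]; exact hle x
  · rw [hin]
    exact (hφ ⟨w, Submodule.mem_span_singleton_self w⟩).trans
      (LinearPMap.mkSpanSingleton'_apply_self _ _ _ _)

theorem clarkeGradient_nonempty (hψ : LocallyLipschitz ψ) (z : Eucl n) :
    (clarkeGradient ψ z).Nonempty :=
  let ⟨zs, h, _⟩ := exists_mem_clarkeGradient hψ z 0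
  ⟨zs, h⟩

theorem clarkeGradient_eq_iInter (ψ : Eucl n → ℝ) (z : Eucl n) :
    clarkeGradient ψ z = ⋂ w, {zs | inner ℝ zs w ≤ clarkeDeriv ψ z w} := by
  ext; simp [clarkeGradient]

theorem convex_clarkeGradient (ψ : Eucl n → ℝ) (z : Eucl n) : Convex ℝ (clarkeGradient ψ z) := by
  rw [clarkeGradient_eq_iInter]
  refine convex_iInter fun w => convex_halfSpace_le ⟨fun x y => ?_, fun c x => ?_⟩ _
  · exact inner_add_left _ _ _
  · exact real_inner_smul_left _ _ _

theorem isCompact_clarkeGradient (hψ : LocallyLipschitz ψ) (z : Eucl n) :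
    IsCompact (clarkeGradient ψ z) := by
  refine Metric.isCompact_of_isClosed_isBounded ?_ ?_
  · rw [clarkeGradient_eq_iInter]
    exact isClosed_iInter fun w => isClosed_le (by fun_prop) continuous_const
  · obtain ⟨L, hL⟩ := exists_clarkeDeriv_le_mul_norm hψ z
    refine isBounded_iff_forall_norm_le.2 ⟨max L 0, fun zs hzs => ?_⟩
    -- Testing `zs` against itself gives `‖zs‖ ^ 2 ≤ L * ‖zs‖`.
    have h := (hzs zs).trans (hL zs)
    rw [real_inner_self_eq_norm_mul_norm] at h
    rcases (norm_nonneg zs).eq_or_lt with h0 | h0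
    · exact h0.ge.trans (le_max_right _ _)
    · exact (le_of_mul_le_mul_right h h0).trans (le_max_left _ _)

end Clarke
-- Interval-valued functions and their enlarged gradients
section Interval

variable {n : ℕ} {f : Eucl n → Itv}

theorem LocLipschitzItv.exists_abs_le (hf : LocLipschitzItv f) (u₀ : Eucl n) :
    ∃ U ∈ 𝓝 u₀, ∃ L : ℝ≥0, ∀ u₁ ∈ U, ∀ u₂ ∈ U,
      |(f u₁).fst - (f u₂).fst| ≤ L * ‖u₁ - u₂‖ ∧ |(f u₁).snd - (f u₂).snd| ≤ L * ‖u₁ - u₂‖ := by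
  obtain ⟨U, hU, L, hL, h⟩ := hf u₀
  refine ⟨U, hU, ⟨L, hL.le⟩, fun u₁ h₁ u₂ h₂ => ?_⟩
  have h12 := h u₁ h₁ u₂ h₂
  simp only [Itv.size, Itv.gHDiff, max_le_iff, abs_le, le_min_iff] at h12
  simp only [abs_le]
  exact ⟨⟨h12.1.1.1, h12.2.2.1⟩, ⟨h12.1.1.2, h12.2.2.2⟩⟩

theorem LocLipschitzItv.center (hf : LocLipschitzItv f) :
    LocallyLipschitz fun z => Itv.center (f z) := fun u₀ => by
  obtain ⟨U, hU, L, h⟩ := hf.exists_abs_le u₀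
  refine ⟨L, U, hU, LipschitzOnWith.of_dist_le_mul fun u₁ h₁ u₂ h₂ => ?_⟩
  obtain ⟨ha, hb⟩ := h u₁ h₁ u₂ h₂
  rw [Real.dist_eq, dist_eq_norm, abs_le, Itv.center, Itv.center]
  rw [abs_le] at ha hb
  constructor <;> linarith [ha.1, ha.2, hb.1, hb.2]

theorem LocLipschitzItv.width (hf : LocLipschitzItv f) :
    LocallyLipschitz fun z => Itv.width (f z) := fun u₀ => by
  obtain ⟨U, hU, L, h⟩ := hf.exists_abs_le u₀
  refine ⟨L, U, hU, LipschitzOnWith.of_dist_le_mul fun u₁ h₁ u₂ h₂ => ?_⟩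
  obtain ⟨ha, hb⟩ := h u₁ h₁ u₂ h₂
  rw [Real.dist_eq, dist_eq_norm, abs_le, Itv.width, Itv.width]
  rw [abs_le] at ha hb
  constructor <;> linarith [ha.1, ha.2, hb.1, hb.2]

theorem isCompact_weakGradient (hf : LocLipschitzItv f) (z : Eucl n) :
    IsCompact (weakGradient f z) :=
  isCompact_convexHull_union (isCompact_clarkeGradient hf.center z)
    (isCompact_clarkeGradient hf.width z) (convex_clarkeGradient _ z) (convex_clarkeGradient _ z)
    (clarkeGradient_nonempty hf.center z) (clarkeGradient_nonempty hf.width z)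

/-- The weakly generalized gradient enlarged by a ball. -/
def enlargedGradient (f : Eucl n → Itv) (r : ℝ) (z : Eucl n) : Set (Eucl n) :=
  weakGradient f z + r • Metric.closedBall (0 : Eucl n) 1

theorem isCompact_enlargedGradient (hf : LocLipschitzItv f) (r : ℝ) (z : Eucl n) :
    IsCompact (enlargedGradient f r z) :=
  (isCompact_weakGradient hf z).add ((isCompact_closedBall _ _).smul r)

theorem convex_enlargedGradient (f : Eucl n → Itv) (r : ℝ) (z : Eucl n) :
    Convex ℝ (enlargedGradient f r z) :=
  (convex_convexHull ℝ _).add ((convex_closedBall _ _).smul r)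

theorem add_mem_enlargedGradient {r : ℝ} {z zs b : Eucl n} (h : zs ∈ weakGradient f z)
    (hb : ‖b‖ ≤ 1) : zs + r • b ∈ enlargedGradient f r z :=
  Set.add_mem_add h (Set.smul_mem_smul_set (mem_closedBall_zero_iff.2 hb))

theorem enlargedGradient_nonempty (hf : LocLipschitzItv f) (r : ℝ) (z : Eucl n) :
    (enlargedGradient f r z).Nonempty :=
  let ⟨_, h⟩ := clarkeGradient_nonempty hf.center z
  ⟨_, add_mem_enlargedGradient (b := 0) (subset_convexHull ℝ _ (Or.inl h)) (by simp)⟩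

theorem exists_norm_le_one_inner_eq_norm (w : Eucl n) :
    ∃ b : Eucl n, ‖b‖ ≤ 1 ∧ inner ℝ b w = ‖w‖ := by
  rcases eq_or_ne w 0 with rfl | hw
  · exact ⟨0, by simp, by simp⟩
  · have h0 : ‖w‖ ≠ 0 := norm_ne_zero_iff.2 hw
    refine ⟨‖w‖⁻¹ • w, ?_, ?_⟩
    · rw [norm_smul, norm_inv, norm_norm, inv_mul_cancel₀ h0]
    · rw [real_inner_smul_left, real_inner_self_eq_norm_mul_norm]
      field_simp

/-- The ball element pointing along `w` contributes exactly `r * ‖w‖`, and the Clarke derivative is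
attained on the gradient. -/
theorem clarkeDeriv_add_lt_zero_of_enlargedGradient (hf : LocLipschitzItv f) {r : ℝ}
    {z w : Eucl n} (h : ∀ c ∈ enlargedGradient f r z, inner ℝ c w < 0) :
    clarkeDeriv (fun z => Itv.center (f z)) z w < -(r * ‖w‖) ∧
      clarkeDeriv (fun z => Itv.width (f z)) z w < -(r * ‖w‖) := by
  obtain ⟨b, hb, hbw⟩ := exists_norm_le_one_inner_eq_norm w
  obtain ⟨c, hc, hcw⟩ := exists_mem_clarkeGradient hf.center z w
  obtain ⟨d, hd, hdw⟩ := exists_mem_clarkeGradient hf.width z w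
  have h1 := h _ (add_mem_enlargedGradient (subset_convexHull ℝ _ (Or.inl hc)) hb)
  have h2 := h _ (add_mem_enlargedGradient (subset_convexHull ℝ _ (Or.inr hd)) hb)
  rw [inner_add_left, real_inner_smul_left, hbw] at h1 h2
  rw [← hcw, ← hdw]
  constructor <;> linarith

/-- Adding `[0, r]` raises center and width by only `r / 2` each, so a margin of `r` suffices. -/
theorem CWLt_add_zeroTo {Q R : Itv} {r : ℝ≥0} (hc : Itv.center Q + r < Itv.center R)
    (hw : Itv.width Q + r < Itv.width R) : Itv.CWLt (Q + Itv.zeroTo r) R := by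
  simp only [Itv.CWLt, Itv.center, Itv.width, NonemptyInterval.fst_add, NonemptyInterval.snd_add,
    Itv.zeroTo] at *
  constructor <;> linarith [r.coe_nonneg]

theorem eventually_add_smul_lt {ψ : Eucl n → ℝ} (hψ : LocallyLipschitz ψ) {z w : Eucl n} {b : ℝ}
    (h : clarkeDeriv ψ z w < b) : ∀ᶠ t in 𝓝[>] (0 : ℝ), ψ (z + t • w) < ψ z + t * b := by
  have ht : Tendsto (fun t : ℝ => (z, t)) (𝓝[>] (0 : ℝ)) (𝓝 z ×ˢ 𝓝[>] (0 : ℝ)) :=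
    tendsto_const_nhds.prodMk tendsto_id
  filter_upwards [ht.eventually (eventually_diffQuot_lt hψ h), self_mem_nhdsWithin] with t h1 h2
  rw [diffQuot, div_lt_iff₀ h2] at h1
  linarith

end Interval

/-! ### Multipliers at a quasi-minimal solution -/

section Multipliers

variable {n m p : ℕ} {F : Fin m → Eucl n → Itv} {g : Fin p → Eucl n → ℝ} {ε : Fin m → ℝ≥0}
  {z : Eucl n}

/-- At a locally weak `ε`-quasi-minimal solution no direction is a common descent direction of the
(perturbed) objectives and the active constraints. -/
theorem IsLocWeakQuasiMin.exists_inner_nonneg (hF : ∀ k, LocLipschitzItv (F k))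
    (hg : ∀ j, LocallyLipschitz (g j)) (hmin : IsLocWeakQuasiMin F (feasible g) ε z)
    (w : Eucl n) :
    (∃ k, ∃ c ∈ enlargedGradient (F k) (ε k) z, 0 ≤ inner ℝ c w) ∨
      ∃ j, g j z = 0 ∧ ∃ c ∈ clarkeGradient (g j) z, 0 ≤ inner ℝ c w := by
  obtain ⟨hz, U, hU, hno⟩ := hmin
  by_contra! hcon
  obtain ⟨hobj, hcons⟩ := hcon
  have htend : Tendsto (fun t : ℝ => z + t • w) (𝓝[>] (0 : ℝ)) (𝓝 z) := by
    have : Continuous (fun t : ℝ => z + t • w) := by fun_prop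
    simpa using (this.tendsto 0).mono_left nhdsWithin_le_nhds
  have hfeas : ∀ᶠ t in 𝓝[>] (0 : ℝ), ∀ j, g j (z + t • w) ≤ 0 := by
    refine eventually_all.2 fun j => ?_
    rcases (hz j).lt_or_eq with hj | hj
    · exact (htend.eventually ((hg j).continuous.tendsto z |>.eventually (gt_mem_nhds hj))).mono
        fun t ht => ht.le
    · obtain ⟨c, hc, hcw⟩ := exists_mem_clarkeGradient (hg j) z w
      have hlt := hcons j hj c hc
      rw [hcw] at hlt
      filter_upwards [eventually_add_smul_lt (hg j) hlt] with t ht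
      rw [hj] at ht
      linarith
  have hdesc : ∀ᶠ t in 𝓝[>] (0 : ℝ), ∀ k,
      Itv.CWLt (F k (z + t • w) + Itv.zeroTo (ε k * ‖z + t • w - z‖₊)) (F k z) := by
    refine eventually_all.2 fun k => ?_
    obtain ⟨hc, hw⟩ := clarkeDeriv_add_lt_zero_of_enlargedGradient (hF k) (hobj k)
    filter_upwards [eventually_add_smul_lt (hF k).center hc,
      eventually_add_smul_lt (hF k).width hw, self_mem_nhdsWithin] with t h1 h2 h3
    have hr : ((ε k * ‖z + t • w - z‖₊ : ℝ≥0) : ℝ) = t * (ε k * ‖w‖) := by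
      rw [add_sub_cancel_left, NNReal.coe_mul, coe_nnnorm, norm_smul,
        Real.norm_of_nonneg (le_of_lt h3)]
      ring
    apply CWLt_add_zeroTo <;> rw [hr] <;> linarith
  obtain ⟨t, h1, h2, h3⟩ := (hfeas.and (hdesc.and (htend.eventually hU))).exists
  exact hno ⟨z + t • w, ⟨h1, h3⟩, h2⟩

/-- Karush-Kuhn-Tucker conditions at a locally weak `ε`-quasi-minimal solution. -/
theorem IsLocWeakQuasiMin.exists_multipliers (hF : ∀ k, LocLipschitzItv (F k))
    (hg : ∀ j, LocallyLipschitz (g j)) (hmin : IsLocWeakQuasiMin F (feasible g) ε z)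
    (hB : BCQ g z) :
    ∃ (lam : Fin m → ℝ) (mu : Fin p → ℝ) (u : Fin m → Eucl n) (v : Fin p → Eucl n),
      (∀ k, 0 ≤ lam k) ∧ ∑ k, lam k = 1 ∧ (∀ j, 0 ≤ mu j) ∧
      (∀ k, u k ∈ enlargedGradient (F k) (ε k) z) ∧ (∀ j, v j ∈ clarkeGradient (g j) z) ∧
      ∑ k, lam k • u k + ∑ j, mu j • v j = 0 ∧ ∀ j, mu j * g j z = 0 := by
  classical
  let D : Fin m ⊕ {j // g j z = 0} → Set (Eucl n) :=
    Sum.elim (fun k => enlargedGradient (F k) (ε k) z) (fun j => clarkeGradient (g j) z)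
  have h0 : (0 : Eucl n) ∈ weightedSums D := by
    refine zero_mem_weightedSums ?_ ?_ ?_ fun w => ?_
    · rintro (k | j)
      exacts [isCompact_enlargedGradient (hF k) _ z, isCompact_clarkeGradient (hg j) z]
    · rintro (k | j)
      exacts [convex_enlargedGradient (F k) _ z, convex_clarkeGradient (g j) z]
    · rintro (k | j)
      exacts [enlargedGradient_nonempty (hF k) _ z, clarkeGradient_nonempty (hg j) z]
    · rcases hmin.exists_inner_nonneg hF hg w with ⟨k, hk⟩ | ⟨j, hj, hc⟩
      exacts [⟨Sum.inl k, hk⟩, ⟨Sum.inr ⟨j, hj⟩, hc⟩]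
  obtain ⟨⟨l, c⟩, ⟨⟨hl, hl1⟩, hc⟩, hsum⟩ := h0
  simp only at hl hl1 hc hsum
  choose v₀ hv₀ using fun j => clarkeGradient_nonempty (hg j) z
  let mu : Fin p → ℝ := fun j => if h : g j z = 0 then l (Sum.inr ⟨j, h⟩) else 0
  -- Inactive constraints get multiplier zero and an arbitrary gradient element.
  let v : Fin p → Eucl n := fun j => if h : g j z = 0 then c (Sum.inr ⟨j, h⟩) else v₀ j
  have hmu : ∀ j, 0 ≤ mu j := fun j => by
    by_cases h : g j z = 0
    · simpa [mu, h] using hl _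
    · simp [mu, h]
  have hmu0 : ∀ j, g j z ≠ 0 → mu j = 0 := fun j h => by simp [mu, h]
  have hv : ∀ j, v j ∈ clarkeGradient (g j) z := fun j => by
    by_cases h : g j z = 0
    · simpa [v, h, D] using hc (Sum.inr ⟨j, h⟩) (Set.mem_univ _)
    · simpa [v, h] using hv₀ j
  have hsub : ∑ j : {j // g j z = 0}, l (Sum.inr j) • c (Sum.inr j) = ∑ j, mu j • v j := by
    rw [← Finset.sum_subset (Finset.subset_univ {j | g j z = 0})
      (fun j _ hj => by rw [hmu0 j (by simpa using hj), zero_smul]),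
      ← Finset.sum_subtype_eq_sum_filter, Finset.subtype_univ]
    exact Finset.sum_congr rfl fun j _ => by simp [mu, v, j.2]
  have hzero : ∑ k, l (Sum.inl k) • c (Sum.inl k) + ∑ j, mu j • v j = 0 := by
    rw [← hsub, ← Fintype.sum_sum_type fun a => l a • c a]
    exact hsum
  set s := ∑ k, l (Sum.inl k) with hs
  have hs0 : 0 ≤ s := Finset.sum_nonneg fun k _ => hl _
  have hspos : 0 < s := by
    -- If the objectives had no weight, all of the total weight 1 would lie on active constraints,
    -- contradicting BCQ.
    refine hs0.lt_of_ne' fun hs' => hB ⟨mu, ?_, hmu, hmu0, ?_⟩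
    · intro hmu'
      have h1 : ∀ j : {j // g j z = 0}, l (Sum.inr j) = 0 := fun j => by
        have := congrFun hmu' j
        simpa [mu, j.2] using this
      rw [Fintype.sum_sum_type, ← hs, hs'] at hl1
      simp [h1] at hl1
    · have h1 : ∀ k, l (Sum.inl k) = 0 := fun k =>
        (Finset.sum_eq_zero_iff_of_nonneg fun k _ => hl (Sum.inl k)).1 hs' k (Finset.mem_univ k)
      rw [Set.mem_fintype_sum]
      exact ⟨fun j => mu j • v j, fun j => Set.smul_mem_smul_set (hv j), by simpa [h1] using hzero⟩
  refine ⟨fun k => s⁻¹ * l (Sum.inl k), fun j => s⁻¹ * mu j, fun k => c (Sum.inl k), v,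
    fun k => mul_nonneg (inv_nonneg.2 hs0) (hl _), ?_,
    fun j => mul_nonneg (inv_nonneg.2 hs0) (hmu j), fun k => hc (Sum.inl k) (Set.mem_univ _), hv,
    ?_, fun j => ?_⟩
  · rw [← Finset.mul_sum, ← hs, inv_mul_cancel₀ hspos.ne']
  · simp only [mul_smul]
    rw [← Finset.smul_sum, ← Finset.smul_sum, ← smul_add, hzero, smul_zero]
  · by_cases h : g j z = 0
    · simp [h]
    · simp [hmu0 j h]

end Multipliers

end MIOP

/-! ### Approximate KKT conditions along a subsequence -/

theorem corollary4p2 {n m p : ℕ}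
    (F : Fin m → MIOP.Eucl n → MIOP.Itv) (g : Fin p → MIOP.Eucl n → ℝ)
    (hF : ∀ k, MIOP.LocLipschitzItv (F k)) (hg : ∀ j, LocallyLipschitz (g j))
    (ε : Fin m → ℝ≥0) (hε : ε ≠ 0)
    (ubar : MIOP.Eucl n)
    (hmin : MIOP.IsLocWeakQuasiMin F (MIOP.feasible g) ε ubar)
    (hBCQ : ∃ U ∈ 𝓝 ubar, ∀ u ∈ MIOP.feasible g ∩ U, MIOP.BCQ g u)
    (e : ℕ → ℝ) (he_pos : ∀ i, 0 < e i) (he_lim : Filter.Tendsto e Filter.atTop (𝓝 0))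
    (x : ℕ → MIOP.Eucl n) (hxS : ∀ i, x i ∈ MIOP.feasible g)
    (hx_lim : Filter.Tendsto x Filter.atTop (𝓝 ubar)) :
    ∃ s : ℕ → ℕ, StrictMono s ∧ ∀ i, ∃ y ∈ MIOP.feasible g,
      ‖x (s i) - y‖ ≤ √(e i) ∧
      ∃ (lam : Fin m → ℝ) (mu : Fin p → ℝ) (u : Fin m → MIOP.Eucl n) (v : Fin p → MIOP.Eucl n),
        (∀ k, 0 ≤ lam k) ∧ ∑ k, lam k = 1 ∧ (∀ j, 0 ≤ mu j) ∧
        (∀ k, u k ∈ MIOP.weakGradient (F k) y +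
          (ε k : ℝ) • Metric.closedBall (0 : MIOP.Eucl n) 1) ∧
        (∀ j, v j ∈ MIOP.clarkeGradient (g j) y) ∧
        ‖∑ k, lam k • u k + ∑ j, mu j • v j‖ ≤ √(e i) ∧
        ∑ j, mu j * g j y = 0 := by
  obtain ⟨U, hU, hB⟩ := hBCQ
  obtain ⟨lam, mu, u, v, hlam, hlam1, hmu, hu, hv, hsum, hcomp⟩ :=
    hmin.exists_multipliers hF hg (hB ubar ⟨hmin.1, mem_of_mem_nhds hU⟩)
  have hclose : ∀ i, ∀ᶠ k in Filter.atTop, ‖x k - ubar‖ ≤ √(e i) := fun i => by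
    have h := (tendsto_iff_norm_sub_tendsto_zero.1 hx_lim).eventually
      (gt_mem_nhds (Real.sqrt_pos.2 (he_pos i)))
    exact h.mono fun k hk => hk.le
  obtain ⟨s, hs, hsx⟩ := Filter.extraction_forall_of_eventually hclose
  refine ⟨s, hs, fun i => ⟨ubar, hmin.1, hsx i, lam, mu, u, v, hlam, hlam1, hmu, hu, hv, ?_, ?_⟩⟩
  · rw [hsum, norm_zero]
    exact Real.sqrt_nonneg _
  · exact Finset.sum_eq_zero fun j _ => hcomp j
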